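/- Let $\tau$ be a finite first-order vocabulary (predicate, function and constant symbols), let $k\in\mathbb{N}$ (with $0\in\mathbb{N}$), and let $\varphi$ be a first-order $\tau$-sentence. All structures have non-empty universes. Call a non-empty collection $R$ of substructures of a $\tau$-structure $M$ a $k$-ary cover of $M$ (and $M$ a $k$-ary covered extension of $R$) if every subset of the universe of $M$ with at most $k$ elements is contained in the universe of some member of $R$. Say that $\varphi$ is preserved under $k$-ary covered extensions, written $\varphi\in PCE(k)$, if for every $\tau$-structure $M$ and every $k$-ary cover $R$ of $M$ such that each $N\in R$ satisfies $\varphi$, also $M$ satisfies $\varphi$. Then $\varphi\in PCE(k)$ if and only if $\varphi$ is logically equivalent to a $\tau$-sentence of the form $\forall x_1\cdots\forall x_k\,\exists y_1\cdots\exists y_m\,\theta$ with $m\in\mathbb{N}$ and $\theta$ quantifier-free, that is, to a $\Pi^0_2$ sentence with exactly $k$ universal quantifiers in its leading block. (For $k=0$ the leading block is empty, so these are the existential sentences.) -/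

import Mathlib

open FirstOrder

universe u v w

/-- `R` is a `k`-ary cover of the structure `M` (equivalently, `M` is a `k`-ary covered extension
of `R`): `R` is a non-empty collection of substructures of `M`, and every subset of `M` with at
most `k` elements is contained in a member of `R`. Structures have non-empty universes by the usual
convention of first-order logic, so the members of `R` are required to be non-empty. -/
def IsKAryCover {L : FirstOrder.Language.{u, v}} (k : ℕ) (M : Type w) [L.Structure M]
    (R : Set (L.Substructure M)) : Prop :=
  R.Nonempty ∧ (∀ N ∈ R, (N : Set M).Nonempty) ∧
    ∀ S : Finset M, S.card ≤ k → ∃ N ∈ R, (S : Set M) ⊆ (N : Set M)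

/-- The class `C` of structures is preserved under `k`-ary covered extensions: whenever a
(non-empty) structure `M` has a `k`-ary cover by structures from `C`, it belongs to `C`. -/
def PreservedUnderCoveredExtensions {L : FirstOrder.Language.{u, v}} (k : ℕ)
    (C : Set (CategoryTheory.Bundled.{w} L.Structure)) : Prop :=
  ∀ (M : Type w) [L.Structure M] [Nonempty M] (R : Set (L.Substructure M)),
    IsKAryCover k M R → (∀ N ∈ R, CategoryTheory.Bundled.of (c := L.Structure) N ∈ C) →
      CategoryTheory.Bundled.of (c := L.Structure) M ∈ C

/-- The class of all (non-empty) models of the sentence `φ`. -/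
def modelClass {L : FirstOrder.Language.{u, v}} (φ : L.Sentence) :
    Set (CategoryTheory.Bundled.{w} L.Structure) :=
  {M | Nonempty M ∧ M ⊨ φ}

/-- `exBlock m θ` is `θ` preceded by a block of `m` existential quantifiers, binding the last `m`
variables. -/
def exBlock {L : FirstOrder.Language.{u, v}} {α : Type w} {n : ℕ} :
    ∀ m : ℕ, L.BoundedFormula α (n + m) → L.BoundedFormula α n
  | 0, θ => θ
  | m + 1, θ => exBlock m (θ : L.BoundedFormula α (n + m + 1)).ex

/-- `ψ` is syntactically of the form `∀ x₁ … ∀ xₖ ∃ y₁ … ∃ yₘ θ` for some `m`, where `θ` is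
quantifier-free: a prenex sentence with exactly `k` universal quantifiers in its leading block,
followed by existential quantifiers. -/
def IsForallExists {L : FirstOrder.Language.{u, v}} (k : ℕ) (ψ : L.Sentence) : Prop :=
  ∃ (m : ℕ) (θ : L.BoundedFormula Empty (k + m)), θ.IsQF ∧ ψ = (exBlock m θ).alls

open Filter

namespace FirstOrder.Language

variable {L : FirstOrder.Language.{u, v}}

/-! Existential formulas pass up from substructures, which gives the easy direction. Conversely, it
suffices that the `∀ᵏ∃*` consequences of `φ` entail `φ`: compactness and closure of this form under
conjunction then give one sentence. Let `M` satisfy these consequences and let `P` be its ultrapower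
over `ℕ`. For a `k`-tuple `a` of `P`, some model of `φ` has a tuple `b` whose existential properties
all hold of `a` (`exists_model_of_forallExists`). Shrink that model to a countable one; saturation
of `P` (`Ultraproduct.exists_realize_of_forall_nat`) embeds it in `P` with `b` going to `a`. So the
substructures of `P` satisfying `φ` form a `k`-ary cover, whence `P`, and by Łoś `M`, satisfies `φ`.
-/

theorem BoundedFormula.realize_exBlock {α : Type w} {M : Type*} [L.Structure M] {n : ℕ} :
    ∀ (m : ℕ) (θ : L.BoundedFormula α (n + m)) (v : α → M) (xs : Fin n → M),
      (exBlock m θ).Realize v xs ↔ ∃ ys : Fin m → M, θ.Realize v (Fin.append xs ys)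
  | 0, θ, v, xs => by
    have h (ys : Fin 0 → M) : Fin.append xs ys = xs := by
      rw [Subsingleton.elim ys Fin.elim0]
      exact Fin.append_elim0 xs
    simp only [h, exists_const]
    rfl
  | m + 1, θ, v, xs => by
    have ih := realize_exBlock m (θ : L.BoundedFormula α (n + m + 1)).ex v xs
    refine ih.trans ?_
    simp only [BoundedFormula.realize_ex]
    constructor
    · rintro ⟨ys, a, h⟩
      exact ⟨Fin.snoc ys a, by rwa [Fin.append_snoc]⟩
    · rintro ⟨ys, h⟩
      refine ⟨Fin.init ys, ys (Fin.last m), ?_⟩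
      rwa [← Fin.append_snoc, Fin.snoc_init_self]

theorem BoundedFormula.IsExistential.exBlock {α : Type w} {n : ℕ} :
    ∀ (m : ℕ) {θ : L.BoundedFormula α (n + m)}, θ.IsExistential →
      (_root_.exBlock m θ).IsExistential
  | 0, _, h => h
  | m + 1, _, h => IsExistential.exBlock m (IsExistential.ex h)

/-! ### Sentences of the form `∀ᵏ∃*` and their conjunctions -/

theorem Formula.realize_congr_freeVarFinset {α : Type*} [DecidableEq α] {M : Type*}
    [L.Structure M] {χ : L.Formula α} {v v' : α → M} (h : ∀ a ∈ χ.freeVarFinset, v a = v' a) :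
    χ.Realize v ↔ χ.Realize v' := by
  have h₁ := BoundedFormula.realize_restrictFreeVar (φ := χ) (f := fun a => (a : α)) (v := v)
    (xs := default) v' fun a => h a a.2
  have h₂ := BoundedFormula.realize_restrictFreeVar (φ := χ) (f := fun a => (a : α)) (v := v)
    (xs := default) v fun a => rfl
  exact h₂.symm.trans h₁

/-- An upper bound for the indices of the variables of `χ` in the summand `ℕ`. -/
def Formula.maxRightVar {k : ℕ} (χ : L.Formula (Fin k ⊕ ℕ)) : ℕ :=
  χ.freeVarFinset.sup (Sum.elim (fun _ => 0) fun n => n)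

/-- The de Bruijn variables of a block of `k` quantifiers followed by a block of `s + 1`. -/
def blockVar (k s : ℕ) : Fin k ⊕ ℕ → Empty ⊕ Fin (k + (s + 1)) :=
  Sum.elim (fun i => Sum.inr (Fin.castAdd _ i)) fun n => Sum.inr (Fin.natAdd k (Fin.ofNat (s + 1) n))

/-- `∀ x₁ … ∀ xₖ ∃ y χ`, where the variables of `χ` in the summand `Fin k` are quantified
universally and those in the summand `ℕ` existentially. -/
def Formula.forallExists {k : ℕ} (χ : L.Formula (Fin k ⊕ ℕ)) : L.Sentence :=
  (exBlock (χ.maxRightVar + 1) (BoundedFormula.relabel (k := 0) (n := k + (χ.maxRightVar + 1))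
    (blockVar k χ.maxRightVar) χ)).alls

theorem Formula.isForallExists_forallExists {k : ℕ} {χ : L.Formula (Fin k ⊕ ℕ)}
    (h : BoundedFormula.IsQF χ) : IsForallExists k χ.forallExists :=
  ⟨χ.maxRightVar + 1, _, BoundedFormula.IsQF.relabel (m := 0) h _, rfl⟩

theorem Formula.realize_forallExists {k : ℕ} (χ : L.Formula (Fin k ⊕ ℕ)) (M : Type*)
    [L.Structure M] [Nonempty M] :
    M ⊨ χ.forallExists ↔
      ∀ x : Fin k → M, ∃ y : ℕ → M, χ.Realize (Sum.elim x y) := by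
  refine BoundedFormula.realize_alls.trans (forall_congr' fun x => ?_)
  rw [BoundedFormula.realize_exBlock]
  simp only [BoundedFormula.realize_relabel]
  -- `Fin.ofNat` reduces indices modulo the block length, which leaves those of the variables
  -- occurring in `χ` unchanged.
  have key (ys : Fin (χ.maxRightVar + 1) → M) (y : ℕ → M)
      (hy : ∀ n < χ.maxRightVar + 1, ys (Fin.ofNat (χ.maxRightVar + 1) n) = y n) :
      BoundedFormula.Realize χ (Sum.elim (default : Empty → M)
        (Fin.append x ys ∘ Fin.castAdd 0) ∘
          blockVar k χ.maxRightVar)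
        (Fin.append x ys ∘ Fin.natAdd _) ↔ χ.Realize (Sum.elim x y) := by
    refine (iff_of_eq (congrArg _ (Subsingleton.elim (α := Fin 0 → M) _ default))).trans ?_
    refine Formula.realize_congr_freeVarFinset ?_
    rintro (i | n) hn
    · exact Fin.append_left x ys i
    · refine (Fin.append_right x ys _).trans (hy n ?_)
      exact Nat.lt_succ_of_le (Finset.le_sup (f := Sum.elim (fun _ => 0) fun n => n) hn)
  constructor
  · rintro ⟨ys, h⟩
    exact ⟨fun n => ys (Fin.ofNat (χ.maxRightVar + 1) n), (key ys _ fun _ _ => rfl).1 h⟩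
  · rintro ⟨y, h⟩
    refine ⟨fun i => y i, (key _ y fun n hn => ?_).2 h⟩
    exact congrArg y (Nat.mod_eq_of_lt hn)

theorem BoundedFormula.IsQF.foldr_sup {α : Type*} {n : ℕ} {l : List (L.BoundedFormula α n)}
    (h : ∀ χ ∈ l, BoundedFormula.IsQF χ) : (l.foldr (· ⊔ ·) ⊥).IsQF := by
  induction l with
  | nil => exact isQF_bot
  | cons χ l ih =>
    exact (h χ (List.mem_cons_self ..)).sup (ih fun ξ hξ => h ξ (List.mem_cons_of_mem _ hξ))

theorem BoundedFormula.IsQF.foldr_inf {α : Type*} {n : ℕ} {l : List (L.BoundedFormula α n)}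
    (h : ∀ χ ∈ l, BoundedFormula.IsQF χ) : (l.foldr (· ⊓ ·) ⊤).IsQF := by
  induction l with
  | nil => exact IsQF.top
  | cons χ l ih =>
    exact (h χ (List.mem_cons_self ..)).inf (ih fun ξ hξ => h ξ (List.mem_cons_of_mem _ hξ))

/-- The conjunction of `∀ x ∃ y χ` and `∀ x ∃ y χ'`, with the two blocks of existential variables
made disjoint. -/
theorem exists_forallExists_inf {k : ℕ} {χ χ' : L.Formula (Fin k ⊕ ℕ)}
    (h : BoundedFormula.IsQF χ) (h' : BoundedFormula.IsQF χ') :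
    ∃ ψ : L.Formula (Fin k ⊕ ℕ), BoundedFormula.IsQF ψ ∧
      (∅ : L.Theory) ⊨ᵇ ψ.forallExists.iff (χ.forallExists ⊓ χ'.forallExists) := by
  let e := Equiv.natSumNatEquivNat
  let g : Fin k ⊕ ℕ → Fin k ⊕ ℕ := Sum.map id fun n => e (Sum.inl n)
  let g' : Fin k ⊕ ℕ → Fin k ⊕ ℕ := Sum.map id fun n => e (Sum.inr n)
  refine ⟨χ.relabel g ⊓ χ'.relabel g', (h.relabel _).inf (h'.relabel _), ?_⟩
  rw [Theory.models_sentence_iff]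
  intro M
  have hi : M ⊨ (χ.forallExists ⊓ χ'.forallExists) ↔
    M ⊨ χ.forallExists ∧ M ⊨ χ'.forallExists := BoundedFormula.realize_inf
  refine BoundedFormula.realize_iff.2 (Iff.trans ?_ hi.symm)
  refine (Formula.realize_forallExists _ M).trans ?_
  rw [Formula.realize_forallExists, Formula.realize_forallExists, ← forall_and]
  refine forall_congr' fun x => ?_
  simp only [Formula.realize_inf, Formula.realize_relabel, g, g', Sum.elim_comp_map,
    Function.comp_id]
  constructor
  · rintro ⟨y, h₁, h₂⟩
    exact ⟨⟨_, h₁⟩, ⟨_, h₂⟩⟩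
  · rintro ⟨⟨y, h₁⟩, ⟨y', h₂⟩⟩
    refine ⟨Sum.elim y y' ∘ e.symm, ?_, ?_⟩
    · simpa [Function.comp_def] using h₁
    · simpa [Function.comp_def] using h₂

theorem exists_forallExists_models_of_finset {k : ℕ} (T : Finset L.Sentence)
    (h : ∀ ψ ∈ T, ∃ χ : L.Formula (Fin k ⊕ ℕ), BoundedFormula.IsQF χ ∧ ψ = χ.forallExists) :
    ∃ χ : L.Formula (Fin k ⊕ ℕ), BoundedFormula.IsQF χ ∧
      ∀ (M : Type (max u v)) [L.Structure M] [Nonempty M],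
        M ⊨ χ.forallExists ↔ ∀ ψ ∈ T, M ⊨ ψ := by
  classical
  induction T using Finset.induction_on with
  | empty =>
    refine ⟨⊤, BoundedFormula.IsQF.top, fun M _ _ => ?_⟩
    simp [Formula.realize_forallExists]
  | insert ψ T _ ih =>
    obtain ⟨χ, hχ, hT⟩ := ih fun ψ hψ => h ψ (Finset.mem_insert_of_mem hψ)
    obtain ⟨χ', hχ', rfl⟩ := h ψ (Finset.mem_insert_self _ _)
    obtain ⟨ξ, hξ, hM⟩ := exists_forallExists_inf hχ' hχ
    refine ⟨ξ, hξ, fun M _ _ => ?_⟩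
    have := BoundedFormula.realize_iff.1 (hM.realize_sentence M)
    have hi : M ⊨ (χ'.forallExists ⊓ χ.forallExists) ↔
      M ⊨ χ'.forallExists ∧ M ⊨ χ.forallExists := BoundedFormula.realize_inf
    rw [Finset.forall_mem_insert, ← hT]
    exact this.trans hi

/-! ### Countable elementary substructures -/

theorem card_le_aleph0_of_countable [Countable L.Symbols] : L.card ≤ Cardinal.aleph0 := by
  rw [card]; exact Cardinal.mk_le_aleph0

theorem exists_countable_elementarySubstructure [Countable L.Symbols] {M : Type*} [L.Structure M]
    {s : Set M} (hs : s.Countable) :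
    ∃ S : L.ElementarySubstructure M, s ⊆ S ∧ Countable S := by
  rcases le_total (Cardinal.mk M) Cardinal.aleph0 with h | h
  · have : Countable M := Cardinal.mk_le_aleph0_iff.1 h
    exact ⟨⊤, fun x _ => ElementarySubstructure.mem_top x, inferInstance⟩
  · have hL : L.card ≤ Cardinal.aleph0 := card_le_aleph0_of_countable
    obtain ⟨S, hS, hc⟩ := exists_elementarySubstructure_card_eq L s Cardinal.aleph0.{0} le_rfl
      (by simpa using hs.le_aleph0) (by simpa using hL) (by simpa using h)
    refine ⟨S, hS, Cardinal.mk_le_aleph0_iff.1 ?_⟩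
    simpa using hc.le

/-- A countable elementary substructure has a copy in every universe. This is needed because
preservation is assumed in one universe only. -/
theorem exists_elementarilyEquivalent_of_countable [Countable L.Symbols] (M : Type*)
    [L.Structure M] [Nonempty M] :
    ∃ (N : Type w) (_ : L.Structure N), Nonempty N ∧ ∀ φ : L.Sentence, N ⊨ φ ↔ M ⊨ φ := by
  obtain ⟨S, hS, hc⟩ := exists_countable_elementarySubstructure (L := L)
    (Set.countable_singleton (Classical.arbitrary M))
  have hne : Nonempty S := ⟨⟨_, hS rfl⟩⟩
  let e := equivShrink.{w} S
  let : L.Structure (Shrink.{w} S) := e.inducedStructure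
  refine ⟨Shrink.{w} S, inferInstance, e.symm.nonempty, fun φ => ?_⟩
  exact (StrongHomClass.realize_sentence e.inducedStructureEquiv φ).symm.trans
    (S.realize_sentence φ)

/-! ### Saturation and embeddings -/

/-- An ultrapower by a nonprincipal ultrafilter on `ℕ` is `ℵ₁`-saturated for sets of
quantifier-free formulas in a countable language. -/
theorem Ultraproduct.exists_realize_of_forall_nat {M : Type*} [L.Structure M] [Nonempty M]
    {α : Type*} (a : α → (hyperfilter ℕ : Filter ℕ).Product fun _ => M)
    (δ : ℕ → L.Formula (α ⊕ ℕ))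
    (h : ∀ n, ∃ y : ℕ → (hyperfilter ℕ : Filter ℕ).Product fun _ => M,
      ∀ j ≤ n, (δ j).Realize (Sum.elim a y)) :
    ∃ y : ℕ → (hyperfilter ℕ : Filter ℕ).Product fun _ => M,
      ∀ j, (δ j).Realize (Sum.elim a y) := by
  classical
  obtain ⟨a, rfl⟩ : ∃ a' : α → ℕ → M, a = fun i => ((a' i : ℕ → M) :
      (hyperfilter ℕ : Filter ℕ).Product fun _ => M) :=
    ⟨fun i => (a i).out, funext fun i => (Quotient.out_eq (a i)).symm⟩
  have hcast (y : ℕ → ℕ → M) (j : ℕ) :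
      (δ j).Realize (Sum.elim (fun i => ((a i : ℕ → M) :
        (hyperfilter ℕ : Filter ℕ).Product fun _ => M)) fun n => (y n :
        (hyperfilter ℕ : Filter ℕ).Product fun _ => M)) ↔
      ∀ᶠ i in (hyperfilter ℕ : Filter ℕ), (δ j).Realize
        (Sum.elim (fun l => a l i) fun n => y n i) := by
    have := realize_formula_cast (u := hyperfilter ℕ) (M := fun _ => M) (δ j) (Sum.elim a y)
    convert this using 2
    · funext x; cases x <;> rfl
    · funext i
      have hx : (Sum.elim (fun l => a l i) fun n => y n i) = fun x => Sum.elim a y x i := by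
        funext x; cases x <;> rfl
      rw [hx]
  let P (i n : ℕ) : Prop := ∃ y : ℕ → M, ∀ j ≤ n, (δ j).Realize (Sum.elim (fun l => a l i) y)
  have hP (n : ℕ) : ∀ᶠ i in (hyperfilter ℕ : Filter ℕ), P i n := by
    obtain ⟨y, hy⟩ := h n
    obtain ⟨y, rfl⟩ : ∃ y' : ℕ → ℕ → M, y = fun i => ((y' i : ℕ → M) :
        (hyperfilter ℕ : Filter ℕ).Product fun _ => M) :=
      ⟨fun i => (y i).out, funext fun i => (Quotient.out_eq (y i)).symm⟩
    have : ∀ᶠ i in (hyperfilter ℕ : Filter ℕ), ∀ j ∈ Set.Iic n, (δ j).Realize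
        (Sum.elim (fun l => a l i) fun n => y n i) :=
      (Set.finite_Iic n).eventually_all.2 fun j hj => (hcast y j).1 (hy j hj)
    exact this.mono fun i hi => ⟨_, hi⟩
  -- Diagonal choice: at index `i`, solve the longest initial segment, of bound at most `i`, that is
  -- solvable there.
  have hz (i : ℕ) : ∃ y : ℕ → M, ∀ n ≤ i, P i n →
      (δ n).Realize (Sum.elim (fun l => a l i) y) := by
    by_cases h0 : ∃ n ≤ i, P i n
    · obtain ⟨n, hn, hPn⟩ := h0
      obtain ⟨y, hy⟩ := Nat.findGreatest_spec (P := P i) hn hPn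
      exact ⟨y, fun n hn hPn => hy n (Nat.le_findGreatest hn hPn)⟩
    · exact ⟨fun _ => Classical.arbitrary M, fun n hn hPn => (h0 ⟨n, hn, hPn⟩).elim⟩
  choose z hz using hz
  refine ⟨fun n => ((fun i => z i n : ℕ → M) :
    (hyperfilter ℕ : Filter ℕ).Product fun _ => M), fun j => (hcast (fun n i => z i n) j).2 ?_⟩
  have hge : ∀ᶠ i in (hyperfilter ℕ : Filter ℕ), j ≤ i :=
    Nat.hyperfilter_le_atTop (eventually_ge_atTop j)
  filter_upwards [hP j, hge] with i hi hji
  exact hz i j hji hi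

/-- A partial map defined on an enumeration of `N` that preserves quantifier-free formulas is an
embedding. -/
theorem exists_embedding_of_forall_isQF {M N : Type*} [L.Structure M] [L.Structure N] {β : Type*}
    {e : β → N} (he : Function.Surjective e) {z : β → M}
    (h : ∀ χ : L.Formula β, BoundedFormula.IsQF χ → χ.Realize e → χ.Realize z) :
    ∃ f : N ↪[L] M, ∀ b, f (e b) = z b := by
  -- Quantifier-free formulas are closed under negation, so preservation is also reflection.
  have hiff (χ : L.Formula β) (hχ : BoundedFormula.IsQF χ) : χ.Realize e ↔ χ.Realize z :=
    ⟨h χ hχ, fun hz => by_contra fun hn => h χ.not hχ.not hn hz⟩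
  have hterm (t s : L.Term β) : t.realize e = s.realize e ↔ t.realize z = s.realize z := by
    simpa using hiff (t.equal s) (BoundedFormula.IsAtomic.equal _ _).isQF
  obtain ⟨r, hr⟩ := he.hasRightInverse
  have hvar (b b' : β) : e b = e b' ↔ z b = z b' := hterm (Term.var b) (Term.var b')
  have hz (b : β) : z (r (e b)) = z b := (hvar _ _).1 (hr _)
  have hcomp {n : ℕ} (x : Fin n → N) : (fun i => e (r (x i))) = x := funext fun i => hr _
  refine ⟨⟨⟨fun x => z (r x), fun x y hxy => ?_⟩, fun {n} f x => ?_, fun {n} R x => ?_⟩, hz⟩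
  · have := (hvar _ _).2 hxy
    rwa [hr, hr] at this
  · have := hterm (Term.var (r (Structure.funMap f x))) (Term.func f fun i => Term.var (r (x i)))
    simp only [Term.realize_var, Term.realize_func, hcomp] at this
    exact this.1 (hr _)
  · have := hiff (R.formula fun i => Term.var (r (x i))) (BoundedFormula.IsAtomic.rel _ _).isQF
    simp only [Formula.realize_rel, Term.realize_var, hcomp] at this
    exact this.symm

/-! ### The two directions -/

theorem _root_.IsForallExists.realize_of_isKAryCover {k : ℕ} {ψ : L.Sentence}
    (hψ : IsForallExists k ψ) {M : Type*} [L.Structure M] {R : Set (L.Substructure M)}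
    (hR : IsKAryCover k M R) (h : ∀ N ∈ R, N ⊨ ψ) : M ⊨ ψ := by
  classical
  obtain ⟨m, θ, hθ, rfl⟩ := hψ
  refine BoundedFormula.realize_alls.2 fun x => ?_
  obtain ⟨N, hN, hx⟩ := hR.2.2 (Finset.univ.image x)
    (Finset.card_image_le.trans_eq (Finset.card_fin k))
  have hx' (i : Fin k) : x i ∈ N := hx (Finset.mem_coe.2 (Finset.mem_image_of_mem x (Finset.mem_univ i)))
  have := BoundedFormula.realize_alls.1 (h N hN) fun i => ⟨x i, hx' i⟩
  have := (hθ.isExistential.exBlock m).realize_embedding N.subtype this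
  rwa [Subsingleton.elim (N.subtype ∘ default) default] at this

/-- If `M` satisfies every `∀ᵏ∃*`-consequence of `φ`, then each `k`-tuple `a` of `M` admits a
model of `φ` with a `k`-tuple all of whose existential properties are shared by `a`. -/
theorem exists_model_of_forallExists {k : ℕ} {φ : L.Sentence} {M : Type*} [L.Structure M]
    [Nonempty M]
    (h : ∀ χ : L.Formula (Fin k ⊕ ℕ), BoundedFormula.IsQF χ →
      (∅ : L.Theory) ⊨ᵇ φ.imp χ.forallExists → M ⊨ χ.forallExists)
    (a : Fin k → M) :
    ∃ (N : Type (max u v)) (_ : L.Structure N) (_ : Nonempty N) (b : Fin k → N), N ⊨ φ ∧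
      ∀ χ : L.Formula (Fin k ⊕ ℕ), BoundedFormula.IsQF χ →
        (∃ y : ℕ → N, χ.Realize (Sum.elim b y)) → ∃ y : ℕ → M, χ.Realize (Sum.elim a y) := by
  classical
  let I := {χ : L.Formula (Fin k ⊕ ℕ) // BoundedFormula.IsQF χ ∧
    ¬∃ y : ℕ → M, χ.Realize (Sum.elim a y)}
  have hs (s : Finset I) : ∃ (N : Theory.ModelType.{u, v, max u v} (∅ : L.Theory)) (b : Fin k → N),
      N ⊨ φ ∧ ∀ χ ∈ s, ¬∃ y : ℕ → N, χ.1.Realize (Sum.elim b y) := by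
    by_contra! hcon
    -- If every `k`-tuple in every model of `φ` realizes some member of `s`, the disjunction yields
    -- a `∀ᵏ∃*` consequence of `φ`; at `a` it contradicts the choice of `I`.
    let ξ : L.Formula (Fin k ⊕ ℕ) := (s.toList.map Subtype.val).foldr (· ⊔ ·) ⊥
    have hqf : BoundedFormula.IsQF ξ := BoundedFormula.IsQF.foldr_sup fun χ hχ => by
      obtain ⟨χ, -, rfl⟩ := List.mem_map.1 hχ
      exact χ.2.1
    have hM := h ξ hqf (Theory.models_sentence_iff.2 fun N => by
      refine BoundedFormula.realize_imp.2 fun hN =>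
        (Formula.realize_forallExists ξ N).2 fun b => ?_
      obtain ⟨χ, hχ, y, hy⟩ := hcon N b hN
      refine ⟨y, (BoundedFormula.realize_foldr_sup _ _ _).2
        ⟨χ.1, List.mem_map.2 ⟨χ, Finset.mem_toList.2 hχ, rfl⟩, hy⟩⟩)
    obtain ⟨y, hy⟩ := (Formula.realize_forallExists ξ M).1 hM a
    obtain ⟨χ, hχ, hy⟩ := (BoundedFormula.realize_foldr_sup _ _ _).1 hy
    obtain ⟨χ, -, rfl⟩ := List.mem_map.1 hχ
    exact χ.2.2 ⟨y, hy⟩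
  choose N b hN hNb using hs
  -- Refining `atTop` puts each given formula of `I` into almost every `s`.
  let U : Ultrafilter (Finset I) := Ultrafilter.of atTop
  refine ⟨(U : Filter (Finset I)).Product fun s => N s, inferInstance, inferInstance,
    fun i => ((fun s => b s i : ∀ s, N s) : (U : Filter (Finset I)).Product fun s => N s),
    (Ultraproduct.sentence_realize φ).2 (Eventually.of_forall hN), fun χ hχ => ?_⟩
  rintro ⟨y, hy⟩
  by_contra hcon
  obtain ⟨y, rfl⟩ : ∃ y' : ℕ → ∀ s, N s, y = fun n => ((y' n : ∀ s, N s) :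
      (U : Filter (Finset I)).Product fun s => N s) :=
    ⟨fun n => (y n).out, funext fun n => (Quotient.out_eq (y n)).symm⟩
  let x : Fin k ⊕ ℕ → ∀ s, N s := Sum.elim (fun i s => b s i) y
  have hx : χ.Realize fun j => ((x j : ∀ s, N s) : (U : Filter (Finset I)).Product fun s => N s) := by
    have hx' : (fun j => ((x j : ∀ s, N s) : (U : Filter (Finset I)).Product fun s => N s)) =
        Sum.elim (fun i => ((fun s => b s i : ∀ s, N s) :
          (U : Filter (Finset I)).Product fun s => N s))
          fun n => ((y n : ∀ s, N s) : (U : Filter (Finset I)).Product fun s => N s) := by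
      funext j; cases j <;> rfl
    rw [hx']
    exact hy
  have hmem : ∀ᶠ s in (U : Filter (Finset I)), (⟨χ, hχ, hcon⟩ : I) ∈ s :=
    (Ultrafilter.of_le _) ((eventually_ge_atTop {⟨χ, hχ, hcon⟩}).mono fun s hs =>
      Finset.singleton_subset_iff.1 hs)
  obtain ⟨s, hs, hs'⟩ := (((Ultraproduct.realize_formula_cast χ x).1 hx).and hmem).exists
  refine hNb s _ hs' ⟨fun n => y n s, ?_⟩
  convert hs using 1
  funext j; cases j <;> rfl

/-- If `M` satisfies every `∀ᵏ∃*`-consequence of `φ`, then every `k`-tuple of its ultrapower lies in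
a substructure satisfying `φ`. -/
theorem exists_substructure_ultrapower [Countable L.Symbols] {k : ℕ} {φ : L.Sentence}
    {M : Type*} [L.Structure M] [Nonempty M]
    (h : ∀ χ : L.Formula (Fin k ⊕ ℕ), BoundedFormula.IsQF χ →
      (∅ : L.Theory) ⊨ᵇ φ.imp χ.forallExists → M ⊨ χ.forallExists)
    (a : Fin k → (hyperfilter ℕ : Filter ℕ).Product fun _ => M) :
    ∃ S : L.Substructure ((hyperfilter ℕ : Filter ℕ).Product fun _ => M),
      (S : Set ((hyperfilter ℕ : Filter ℕ).Product fun _ => M)).Nonempty ∧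
        (∀ i, a i ∈ S) ∧ S ⊨ φ := by
  obtain ⟨N, _, _, b, hN, hab⟩ := exists_model_of_forallExists (φ := φ)
    (fun χ hχ hφ => (Ultraproduct.sentence_realize (u := hyperfilter ℕ) _).2
      (Eventually.of_forall fun _ => h χ hχ hφ)) a
  -- The extra element keeps `S` non-empty when `k = 0`.
  obtain ⟨S, hS, _⟩ := exists_countable_elementarySubstructure (L := L)
    ((Set.countable_range b).insert (Classical.arbitrary N))
  have : Nonempty S := ⟨⟨_, hS (Set.mem_insert _ _)⟩⟩
  let b' : Fin k → S := fun i => ⟨b i, hS (Set.mem_insert_of_mem _ (Set.mem_range_self i))⟩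
  obtain ⟨e, he⟩ := exists_surjective_nat S
  have : Nonempty {χ : L.Formula (Fin k ⊕ ℕ) //
    BoundedFormula.IsQF χ ∧ χ.Realize (Sum.elim b' e)} := ⟨⊤, BoundedFormula.IsQF.top, by simp⟩
  obtain ⟨δ, hδ⟩ := exists_surjective_nat {χ : L.Formula (Fin k ⊕ ℕ) //
    BoundedFormula.IsQF χ ∧ χ.Realize (Sum.elim b' e)}
  obtain ⟨z, hz⟩ := Ultraproduct.exists_realize_of_forall_nat a (fun n => (δ n).1) fun n => by
    let ξ : L.Formula (Fin k ⊕ ℕ) :=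
      ((List.range (n + 1)).map fun j => (δ j).1).foldr (· ⊓ ·) ⊤
    have hqf : BoundedFormula.IsQF ξ := BoundedFormula.IsQF.foldr_inf fun χ hχ => by
      obtain ⟨j, -, rfl⟩ := List.mem_map.1 hχ
      exact (δ j).2.1
    have hξ : ξ.Realize (Sum.elim b' e) := (BoundedFormula.realize_foldr_inf _ _ _).2 fun χ hχ => by
      obtain ⟨j, -, rfl⟩ := List.mem_map.1 hχ
      exact (δ j).2.2
    have hξ' : ξ.Realize (Sum.elim b fun n => (e n : N)) := by
      have := (S.subtype.map_formula ξ _).2 hξ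
      rwa [Sum.comp_elim] at this
    obtain ⟨y, hy⟩ := hab ξ hqf ⟨_, hξ'⟩
    exact ⟨y, fun j hj => (BoundedFormula.realize_foldr_inf _ _ _).1 hy _
      (List.mem_map.2 ⟨j, List.mem_range.2 (Nat.lt_succ_of_le hj), rfl⟩)⟩
  obtain ⟨f, hf⟩ := exists_embedding_of_forall_isQF (e := Sum.elim b' e) (z := Sum.elim a z)
    (fun x => (he x).imp' Sum.inr fun _ h => h) fun χ hχ hr => by
      obtain ⟨n, hn⟩ := hδ ⟨χ, hχ, hr⟩
      have := hz n
      rwa [hn] at this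
  refine ⟨f.toHom.range, ⟨_, Hom.mem_range.2 ⟨Classical.arbitrary S, rfl⟩⟩,
    fun i => Hom.mem_range.2 ⟨b' i, hf (Sum.inl i)⟩, ?_⟩
  exact (StrongHomClass.realize_sentence f.equivRange φ).1 ((S.realize_sentence φ).2 hN)

theorem realize_of_preservedUnderCoveredExtensions [Countable L.Symbols] {k : ℕ} {φ : L.Sentence}
    (hφ : PreservedUnderCoveredExtensions.{u, v, w} k (modelClass φ)) {M : Type*} [L.Structure M]
    [Nonempty M]
    (h : ∀ χ : L.Formula (Fin k ⊕ ℕ), BoundedFormula.IsQF χ →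
      (∅ : L.Theory) ⊨ᵇ φ.imp χ.forallExists → M ⊨ χ.forallExists) : M ⊨ φ := by
  obtain ⟨N, _, _, hNM⟩ := exists_elementarilyEquivalent_of_countable.{u, v, w} (L := L) M
  simp only [← hNM] at h ⊢
  let P := (hyperfilter ℕ : Filter ℕ).Product fun _ => N
  have hcov : ∀ s : Finset P, s.card ≤ k →
      ∃ S ∈ {S : L.Substructure P | (S : Set P).Nonempty ∧ S ⊨ φ}, (s : Set P) ⊆ S := by
    intro s hs
    -- Sets with fewer than `k` elements are padded to a `k`-tuple.
    obtain ⟨a, ha⟩ : ∃ a : Fin k → P, ∀ x ∈ s, x ∈ Set.range a := by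
      refine ⟨fun i => if hi : i.1 < s.card then s.equivFin.symm ⟨i, hi⟩ else Classical.arbitrary P,
        fun x hx => ?_⟩
      have hlt := (s.equivFin ⟨x, hx⟩).2
      exact ⟨⟨s.equivFin ⟨x, hx⟩, hlt.trans_le hs⟩, by simp⟩
    obtain ⟨S, hne, hS, hSφ⟩ := exists_substructure_ultrapower h a
    refine ⟨S, ⟨hne, hSφ⟩, fun x hx => ?_⟩
    obtain ⟨i, rfl⟩ := ha x hx
    exact hS i
  have hP := hφ P {S | (S : Set P).Nonempty ∧ S ⊨ φ}
    ⟨(hcov ∅ (Nat.zero_le _)).imp fun _ h => h.1, fun S hS => hS.1, hcov⟩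
    fun S hS => ⟨hS.1.to_subtype, hS.2⟩
  exact ((Ultraproduct.sentence_realize φ).1 hP.2).exists.choose_spec

end FirstOrder.Language

open FirstOrder.Language in
theorem theorem4 {L : FirstOrder.Language.{u, v}} [Finite L.Symbols] (k : ℕ) (φ : L.Sentence) :
    PreservedUnderCoveredExtensions.{u, v, w} k (modelClass φ) ↔
      ∃ ψ : L.Sentence, IsForallExists k ψ ∧ φ ⇔[(∅ : L.Theory)] ψ := by
  constructor
  · intro hφ
    let Γ : L.Theory := {ψ | ∃ χ : L.Formula (Fin k ⊕ ℕ), BoundedFormula.IsQF χ ∧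
      (∅ : L.Theory) ⊨ᵇ φ.imp χ.forallExists ∧ ψ = χ.forallExists}
    have hΓ : Γ ⊨ᵇ φ := Theory.models_sentence_iff.2 fun M =>
      realize_of_preservedUnderCoveredExtensions hφ fun χ hχ h =>
        Theory.realize_sentence_of_mem Γ ⟨χ, hχ, h, rfl⟩
    obtain ⟨T, hT, hTφ⟩ := Theory.models_iff_finset_models.1 hΓ
    obtain ⟨χ, hχ, hM⟩ := exists_forallExists_models_of_finset T fun ψ hψ =>
      (hT hψ).imp fun χ h => ⟨h.1, h.2.2⟩
    refine ⟨χ.forallExists, Formula.isForallExists_forallExists hχ,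
      Theory.models_sentence_iff.2 fun M => BoundedFormula.realize_iff.2 ?_⟩
    refine Iff.trans ⟨fun h ψ hψ => ?_, fun h => ?_⟩ (hM M).symm
    · obtain ⟨ξ, -, hξ, rfl⟩ := hT hψ
      exact BoundedFormula.realize_imp.1 (hξ.realize_sentence M) h
    · have : M ⊨ (T : L.Theory) := ⟨h⟩
      exact hTφ.realize_sentence M
  · rintro ⟨ψ, hψ, hφψ⟩ M _ hne R hR hN
    refine ⟨hne, (Theory.Iff.models_sentence_iff (M := M) hφψ).2
      (hψ.realize_of_isKAryCover hR fun N hNR => ?_)⟩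
    have : Nonempty N := (hN N hNR).1
    exact (Theory.Iff.models_sentence_iff (M := N) hφψ).1 (hN N hNR).2
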